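/- A finite equivalence relation is a pair $(X,\rho)$ where $X$ is a finite linearly ordered set and $\rho$ is an equivalence relation on $X$; up to order isomorphism we may take $X=[n]=\{1,\dots,n\}$ with its natural order. For finite equivalence relations $(X,\rho)$ and $(Y,\sigma)$ with $X=\{x_1<\dots<x_n\}$ and $Y=\{y_1<\dots<y_m\}$, write $(X,\rho)\leq_{\mathrm{cons}}(Y,\sigma)$ if there is an integer $k\ge 1$ with $k+n-1\le m$ such that, for all $i,j\in\{1,\dots,n\}$, $(x_i,x_j)\in\rho$ if and only if $(y_{k+i-1},y_{k+j-1})\in\sigma$. This is a partial order on the set $\overline{\mathrm{Eq}}$ of finite equivalence relations up to order isomorphism, called the consecutive embedding order. For $B\subseteq\overline{\mathrm{Eq}}$ let $$\mathrm{Av}(B)=\{\sigma\in\overline{\mathrm{Eq}} : \rho\not\leq_{\mathrm{cons}}\sigma \text{ for all } \rho\in B\}.$$ A downward closed set $C\subseteq\overline{\mathrm{Eq}}$ is atomic if it is not the union of two downward closed proper subsets of $C$. Theorem. It is decidable whether a finitely based avoidance set $\mathrm{Av}(B)$ is atomic under the consecutive embedding order. That is, there is an algorithm which takes as input an arbitrary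 finite set $B\subseteq\overline{\mathrm{Eq}}$ (given as a finite list of relations, each relation on $[n]$ being given by a list of $n$ natural-number labels such that two points are related if and only if they have the same label), always halts, and correctly answers whether $\mathrm{Av}(B)$ is atomic. -/

import Mathlib

/-! Finite equivalence relations under the consecutive embedding order, avoidance sets,
atomicity, and presentations of finite sets of relations as inputs of an algorithm. -/

namespace ConsEq

/-- A finite equivalence relation with a linear order on its points, up to order isomorphism:
an equivalence relation on the naturally ordered set of `length` points. -/
structure FinEquiv where
  /-- the number of points -/
  length : ℕ
  /-- the relation on the points -/
  rel : Setoid (Fin length)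

/-- The map from `n` points to `m` points that sends the `i`-th point to the `(k + i)`-th point.
As `k` varies, these are exactly the contiguous (consecutive) maps. -/
def shift {n m : ℕ} (k : ℕ) (h : k + n ≤ m) (i : Fin n) : Fin m :=
  ⟨k + i, by omega⟩

/-- `ρ` embeds consecutively in `σ`: some contiguous map `f` satisfies
`x ~ y ↔ f x ~ f y` for all points `x`, `y` of `ρ`. -/
def ConsEmbeds (ρ σ : FinEquiv) : Prop :=
  ∃ (k : ℕ) (h : k + ρ.length ≤ σ.length),
    ∀ i j : Fin ρ.length, ρ.rel i j ↔ σ.rel (shift k h i) (shift k h j)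

/-- The poset of finite equivalence relations under the consecutive embedding order. -/
instance : PartialOrder FinEquiv where
  le := ConsEmbeds
  le_refl ρ := ⟨0, by omega, fun i j => by simp [shift]⟩
  le_trans ρ σ τ := by
    rintro ⟨k, h, hk⟩ ⟨l, h', hl⟩
    refine ⟨l + k, by omega, fun i j => ?_⟩
    rw [hk, hl]
    simp [shift, Nat.add_assoc]
  le_antisymm ρ σ := by
    rintro ⟨k, h, hk⟩ ⟨l, h', -⟩
    obtain ⟨n, r⟩ := ρ
    obtain ⟨m, s⟩ := σ
    dsimp only at h h' hk
    obtain rfl : n = m := by omega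
    obtain rfl : k = 0 := by omega
    congr 1
    ext i j
    simpa [shift] using hk i j

/-- The avoidance set of `B`. -/
def Av {X : Type*} [PartialOrder X] (B : Set X) : Set X :=
  {x | ∀ y ∈ B, ¬ y ≤ x}

/-- A downward closed set is atomic if it is not the union of two downward closed
proper subsets. -/
def Atomic {X : Type*} [PartialOrder X] (C : Set X) : Prop :=
  IsLowerSet C ∧
    ¬ ∃ D E : Set X, IsLowerSet D ∧ IsLowerSet E ∧ D ⊂ C ∧ E ⊂ C ∧ C = D ∪ E

/-- The equivalence relation described by a list of class labels: the points are the positions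
of the list, and two points are related when they carry the same label.
For example `[0, 1, 0]` describes the relation with classes `{1, 3}` and `{2}`. -/
def ofLabels (w : List ℕ) : FinEquiv where
  length := w.length
  rel := Setoid.ker w.get

/-- The finite set of equivalence relations described by a finite list of label lists. -/
def presented (L : List (List ℕ)) : Set FinEquiv :=
  {ρ | ∃ w ∈ L, ρ = ofLabels w}

theorem ofLabels_eq {n : ℕ} (r : Setoid (Fin n)) (w : List ℕ) (h : w.length = n)
    (hr : ∀ i j : Fin w.length, w.get i = w.get j ↔ r (Fin.cast h i) (Fin.cast h j)) :
    ofLabels w = ⟨n, r⟩ := by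
  subst h
  unfold ofLabels
  congr 1
  ext i j
  exact hr i j

/-- Every finite equivalence relation is described by some list of labels. -/
theorem ofLabels_surjective : Function.Surjective ofLabels := by
  classical
  rintro ⟨n, r⟩
  let f : Fin n → ℕ := fun i => ((Quotient.out (Quotient.mk r i) : Fin n) : ℕ)
  have hf : ∀ i j, f i = f j ↔ r i j := fun i j => by
    simp only [f, Fin.val_inj, Quotient.out_inj]
    exact Quotient.eq
  refine ⟨List.ofFn f, ofLabels_eq r _ (by simp) fun i j => ?_⟩
  rw [← hf, List.get_ofFn, List.get_ofFn]

/-- The sets that can be given as input are exactly the finite sets of finite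
equivalence relations. -/
theorem range_presented : Set.range presented = {B : Set FinEquiv | B.Finite} := by
  ext B
  constructor
  · rintro ⟨L, rfl⟩
    refine ((L.map ofLabels).finite_toSet).subset ?_
    rintro ρ ⟨w, hw, rfl⟩
    exact List.mem_map.2 ⟨w, hw, rfl⟩
  · intro hB
    obtain ⟨g, hg⟩ := ofLabels_surjective.hasRightInverse
    have hB' : B.Finite := hB
    refine ⟨hB'.toFinset.toList.map g, ?_⟩
    ext ρ
    constructor
    · rintro ⟨w, hw, rfl⟩
      obtain ⟨σ, hσ, rfl⟩ := List.mem_map.1 hw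
      rw [hg]
      simpa using hσ
    · intro hρ
      exact ⟨g ρ, List.mem_map.2 ⟨ρ, by simpa using hρ, rfl⟩, (hg ρ).symm⟩

end ConsEq

/-! Label lists are treated as words up to renaming of labels. With `b` bounding the lengths of the
forbidden words, avoidance is local: two avoiding words agreeing on an overlap of length `b` can be
glued (`isLocalClass_avoids`, `exists_glue_choice`). An avoidance set is atomic iff it has joint
embedding (`atomic_av_iff`), so it suffices to bound the words to be tested and the common
extensions to be searched.

Think of windows of length `b` as vertices and windows of length `b + 1` as edges, with `Reach` as
the existence of a path. Assume joint embedding for short words. If every edge of two words can be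
undone, each word can be traversed backwards, and a path between the two lets them be glued one
after the other. An edge that cannot be undone occurs at most once in a word, and then the class is
rigid: words of equal length with that edge at the same position have the same shape
(`sameShape_of_irreversible`). Any other word occurs together with that edge, and words sharing it
can be superimposed. Hence joint embedding for short words implies it for all
(`compat_of_jointUpTo`).

Conversely, a common extension shrinks by cutting between repeated windows
(`exists_short_of_compat`). Atomicity thus becomes a bounded search, which is primitive recursive.
-/

namespace ConsEq

/-! ### Shapes of windows and local classes -/

/-- The windows of length `n` of `f` at `p` and of `g` at `q` carry the same equivalence relation. -/
def SameShape (f : ℕ → ℕ) (p : ℕ) (g : ℕ → ℕ) (q n : ℕ) : Prop :=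
  ∀ i < n, ∀ j < n, (f (p + i) = f (p + j) ↔ g (q + i) = g (q + j))

namespace SameShape

variable {f g h : ℕ → ℕ} {p q r n m k : ℕ}

theorem refl (f : ℕ → ℕ) (p n : ℕ) : SameShape f p f p n := fun _ _ _ _ => Iff.rfl

theorem symm (H : SameShape f p g q n) : SameShape g q f p n :=
  fun i hi j hj => (H i hi j hj).symm

theorem trans (H : SameShape f p g q n) (H' : SameShape g q h r n) : SameShape f p h r n :=
  fun i hi j hj => (H i hi j hj).trans (H' i hi j hj)

theorem sub (H : SameShape f p g q n) (k : ℕ) (hk : k + m ≤ n) :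
    SameShape f (p + k) g (q + k) m := by
  intro i hi j hj
  have := H (k + i) (by omega) (k + j) (by omega)
  simpa only [Nat.add_assoc] using this

theorem take (H : SameShape f p g q n) (hk : m ≤ n) : SameShape f p g q m :=
  fun i hi j hj => H i (by omega) j (by omega)

/-- A variant of `SameShape.sub` with free positions. -/
theorem sub' (H : SameShape f p g q n) (k : ℕ) {p' q' : ℕ} (hk : k + m ≤ n)
    (hp : p' = p + k) (hq : q' = q + k) : SameShape f p' g q' m := by
  subst hp hq; exact H.sub k hk

theorem shift (f : ℕ → ℕ) (p n : ℕ) : SameShape (fun i => f (p + i)) 0 f p n := by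
  intro i _ j _
  simp

end SameShape

/-- `W f p n` says that the window of length `n` of `f` at `p` belongs to a class of words
that is closed under windows, depends on shapes only, and is determined by windows of
length at most `b`. -/
structure IsLocalClass (b : ℕ) (W : (ℕ → ℕ) → ℕ → ℕ → Prop) : Prop where
  mono : ∀ {f p n q m}, W f p n → p ≤ q → q + m ≤ p + n → W f q m
  congr : ∀ {f p g q n}, SameShape f p g q n → W f p n → W g q n
  append : ∀ {f p n m}, W f p (n + b) → W f (p + n) (b + m) → W f p (n + b + m)

/-- Two windows occur together in some member of `W`. -/
def Compat (W : (ℕ → ℕ) → ℕ → ℕ → Prop) (f : ℕ → ℕ) (p n : ℕ) (g : ℕ → ℕ) (q m : ℕ) : Prop :=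
  ∃ h l s t, W h 0 l ∧ s + n ≤ l ∧ t + m ≤ l ∧ SameShape f p h s n ∧ SameShape g q h t m

/-- Joint embedding for members of length at most `N`. -/
def JointUpTo (W : (ℕ → ℕ) → ℕ → ℕ → Prop) (N : ℕ) : Prop :=
  ∀ f p n g q m, n ≤ N → m ≤ N → W f p n → W g q m → Compat W f p n g q m

theorem Compat.symm {W : (ℕ → ℕ) → ℕ → ℕ → Prop} {f p n g q m} (H : Compat W f p n g q m) :
    Compat W g q m f p n := by
  obtain ⟨h, l, s, t, a, b, c, d, e⟩ := H
  exact ⟨h, l, t, s, a, c, b, e, d⟩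

/-! ### Amalgamation along an overlap -/

open Classical in
/-- Amalgamation of two words along an overlap of length `b`, with the freedom to relate or not
to relate two points that are unrelated to the overlap. -/
theorem exists_glue_choice (f g : ℕ → ℕ) (n b m : ℕ) (H : SameShape f n g 0 b) (i j : ℕ)
    (c : Bool) (hi : c = true → ∀ k < b, f i ≠ f (n + k)) :
    ∃ h, SameShape h 0 f 0 (n + b) ∧ SameShape h n g 0 (b + m) ∧
      (i < n + b → b ≤ j → (∀ k < b, g j ≠ g k) → (h i = h (n + j) ↔ c = true)) := by
  -- Labels of `g` are renamed: those met in the overlap follow `f` (doubled), the label of `g j`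
  -- becomes that of `f i` when `c` asks for it, and all others become odd, hence fresh. Both
  -- restrictions keep their shape because `φ` is injective; `hi` prevents the chosen label from
  -- colliding with the overlap.
  let φ : ℕ → ℕ := fun x =>
    if hx : ∃ k < b, g k = x then 2 * f (n + hx.choose)
    else if x = g j ∧ c = true then 2 * f i else 2 * x + 1
  have hφ1 : ∀ k < b, φ (g k) = 2 * f (n + k) := by
    intro k hk
    have hx : ∃ k' < b, g k' = g k := ⟨k, hk, rfl⟩
    simp only [φ, dif_pos hx]
    have := (H hx.choose hx.choose_spec.1 k hk).2 (by simpa using hx.choose_spec.2)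
    omega
  have hφ2 : ∀ x, (¬ ∃ k < b, g k = x) → φ x = if x = g j ∧ c = true then 2 * f i else 2 * x + 1 := by
    intro x hx
    simp only [φ, dif_neg hx]
  have hφinj : ∀ x y, φ x = φ y → x = y := by
    have key : ∀ k < b, ∀ y, (¬ ∃ k < b, g k = y) → φ (g k) ≠ φ y := by
      intro k hk y hy
      rw [hφ1 k hk, hφ2 y hy]
      split_ifs with h
      · have := hi h.2 k hk
        omega
      · omega
    intro x y hxy
    by_cases hx : ∃ k < b, g k = x <;> by_cases hy : ∃ k < b, g k = y
    · obtain ⟨k, hk, rfl⟩ := hx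
      obtain ⟨l, hl, rfl⟩ := hy
      rw [hφ1 k hk, hφ1 l hl] at hxy
      have := (H k hk l hl).1 (by omega)
      simpa using this
    · obtain ⟨k, hk, rfl⟩ := hx
      exact absurd hxy (key k hk y hy)
    · obtain ⟨l, hl, rfl⟩ := hy
      exact absurd hxy.symm (key l hl x hx)
    · rw [hφ2 x hx, hφ2 y hy] at hxy
      split_ifs at hxy with h1 h2 <;> omega
  have hfar : ∀ x, x < b + m → (if n + x < n + b then 2 * f (n + x) else φ (g x)) = φ (g x) := by
    intro x _
    split_ifs with hx
    · rw [hφ1 x (by omega)]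
    · rfl
  refine ⟨fun x => if x < n + b then 2 * f x else φ (g (x - n)), ?_, ?_, ?_⟩
  · intro x hx y hy
    simp only [Nat.zero_add, hx, hy, if_true]
    omega
  · intro x hx y hy
    simp only [Nat.add_sub_cancel_left, Nat.zero_add, hfar x hx, hfar y hy]
    exact ⟨fun e => hφinj _ _ e, fun e => by rw [e]⟩
  · intro hin hbj hj
    have h1 : ¬ n + j < n + b := by omega
    have h2 : ¬ ∃ k < b, g k = g j := by
      rintro ⟨k, hk, e⟩
      exact hj k hk e.symm
    simp only [hin, if_true, h1, if_false, Nat.add_sub_cancel_left, hφ2 _ h2]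
    cases c <;> simp
    omega

namespace IsLocalClass

variable {b : ℕ} {W : (ℕ → ℕ) → ℕ → ℕ → Prop}

theorem of_glue (hW : IsLocalClass b W) {f g h : ℕ → ℕ} {n m p : ℕ} (hf : W f 0 (n + b))
    (hg : W g p (b + m)) (h1 : SameShape h 0 f 0 (n + b)) (h2 : SameShape h n g p (b + m)) :
    W h 0 (n + b + m) := by
  apply hW.append (hW.congr h1.symm hf)
  rw [Nat.zero_add]
  exact hW.congr h2.symm hg

theorem glue (hW : IsLocalClass b W) {f g : ℕ → ℕ} {p q n m : ℕ} (hf : W f p (n + b))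
    (hg : W g q (b + m)) (H : SameShape f (p + n) g q b) :
    ∃ h, SameShape h 0 f p (n + b) ∧ SameShape h n g q (b + m) ∧ W h 0 (n + b + m) := by
  have hf' := hW.congr (SameShape.shift f p (n + b)).symm hf
  have hg' := hW.congr (SameShape.shift g q (b + m)).symm hg
  have H' : SameShape (fun i => f (p + i)) n (fun i => g (q + i)) 0 b := by
    intro i hi j hj
    have := H i hi j hj
    simpa [Nat.add_assoc] using this
  obtain ⟨h, h1, h2, -⟩ := exists_glue_choice _ _ n b m H' 0 0 false (by simp)
  exact ⟨h, h1.trans (SameShape.shift f p _), h2.trans (SameShape.shift g q _),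
    hW.of_glue hf' hg' h1 h2⟩

end IsLocalClass

/-! ### Pigeonhole on windows, and reachability between them -/

/-- The shape of the window of length `b` at `p`, as a colour. -/
def shapeAt (b : ℕ) (f : ℕ → ℕ) (p : ℕ) : Fin b → Fin b → Bool :=
  fun i j => decide (f (p + i) = f (p + j))

theorem sameShape_of_shapeAt_eq {b : ℕ} {f g : ℕ → ℕ} {p q : ℕ}
    (H : shapeAt b f p = shapeAt b g q) : SameShape f p g q b := by
  intro i hi j hj
  simpa [shapeAt] using congrFun (congrFun H ⟨i, hi⟩) ⟨j, hj⟩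

/-- The number of colours used for windows of length `b`. -/
def numShapes (b : ℕ) : ℕ := 2 ^ (b * b)

theorem card_shapes (b : ℕ) : Fintype.card (Fin b → Fin b → Bool) = numShapes b := by
  simp [numShapes, pow_mul]

theorem exists_lt_map_eq {α : Type*} [Fintype α] (c : ℕ → α) {m : ℕ} (hm : Fintype.card α < m) :
    ∃ s t, s < t ∧ t < m ∧ c s = c t := by
  obtain ⟨x, y, hxy, e⟩ :=
    Fintype.exists_ne_map_eq_of_card_lt (fun i : Fin m => c i) (by simpa using hm)
  rcases lt_or_gt_of_ne hxy with h | h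
  · exact ⟨x, y, h, y.2, e⟩
  · exact ⟨y, x, h, x.2, e.symm⟩

/-- Some member of `W` starts with the `b`-window of `f` at `p` and ends with the `b`-window
of `g` at `q`. -/
def Reach (b : ℕ) (W : (ℕ → ℕ) → ℕ → ℕ → Prop) (f : ℕ → ℕ) (p : ℕ) (g : ℕ → ℕ) (q : ℕ) : Prop :=
  ∃ h n, W h 0 (n + b) ∧ SameShape h 0 f p b ∧ SameShape h n g q b

namespace IsLocalClass

variable {b N : ℕ} {W : (ℕ → ℕ) → ℕ → ℕ → Prop} {e f g h : ℕ → ℕ} {l m n p q r s t : ℕ}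

/-- The stretch between two equal windows can be deleted, by gluing the prefix through the first to
the suffix from the second. Relations across the cut are not controlled. -/
theorem cut (hW : IsLocalClass b W) (hf : W f 0 n) (hst : s < t) (ht : t + b ≤ n)
    (H : SameShape f s f t b) :
    ∃ h, SameShape h 0 f 0 (s + b) ∧ SameShape h s f t (n - t) ∧ W h 0 (n - (t - s)) := by
  obtain ⟨h, h1, h2, h3⟩ := hW.glue (f := f) (g := f) (p := 0) (q := t) (n := s)
    (m := n - t - b) (hW.mono hf le_rfl (by omega)) (hW.mono hf (by omega) (by omega))
    (by simpa using H)
  refine ⟨h, h1, ?_, ?_⟩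
  · rwa [show b + (n - t - b) = n - t by omega] at h2
  · rwa [show s + b + (n - t - b) = n - (t - s) by omega] at h3

theorem reach_of_le (hW : IsLocalClass b W) (hh : W h p l) (hp : p ≤ s) (hst : s ≤ t)
    (ht : t + b ≤ p + l) (h1 : SameShape h s f r b) (h2 : SameShape h t g q b) :
    Reach b W f r g q := by
  refine ⟨fun i => h (s + i), t - s, ?_, ?_, ?_⟩
  · exact hW.congr (SameShape.shift h s _).symm (hW.mono hh hp (by omega))
  · exact (SameShape.shift h s _).trans h1
  · refine SameShape.trans ?_ h2
    have := (SameShape.shift h s (t - s + b)).sub (m := b) (t - s) le_rfl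
    rwa [Nat.zero_add, show s + (t - s) = t by omega] at this

theorem reach_trans (hW : IsLocalClass b W) (H : Reach b W e p f q) (H' : Reach b W f q g r) :
    Reach b W e p g r := by
  obtain ⟨h, n, a1, a2, a3⟩ := H
  obtain ⟨k, m, b1, b2, b3⟩ := H'
  rw [Nat.add_comm] at b1
  obtain ⟨u, c1, c2, c3⟩ := hW.glue a1 b1 (by rw [Nat.zero_add]; exact a3.trans b2.symm)
  refine ⟨u, n + m, by rwa [Nat.add_right_comm] at c3, (c1.take (by omega)).trans a2, ?_⟩
  exact (c2.sub' m (by omega) rfl (Nat.zero_add m).symm).trans b3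

/-! ### Rigidity around an irreversible window -/

/-- An irreversible window occurs at most once in any member of the class. -/
theorem occurrence_unique (hW : IsLocalClass b W) (he : ¬ Reach b W e 1 e 0) (hh : W h 0 l)
    (hs : s + (b + 1) ≤ l) (ht : t + (b + 1) ≤ l) (h1 : SameShape h s e 0 (b + 1))
    (h2 : SameShape h t e 0 (b + 1)) : s = t := by
  -- With `s < t`, the word itself leads from the end of the first occurrence, at `s + 1`, to the
  -- start of the second, at `t`.
  have key : ∀ {s t}, s < t → t + (b + 1) ≤ l → SameShape h s e 0 (b + 1) →
      SameShape h t e 0 (b + 1) → False := by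
    intro s t hst ht h1 h2
    exact he (hW.reach_of_le hh (Nat.zero_le (s + 1)) hst (by omega)
      (h1.sub' 1 (by omega) rfl rfl) (h2.take (by omega)))
  rcases lt_trichotomy s t with h | h | h
  · exact (key h ht h1 h2).elim
  · exact h
  · exact (key h hs h2 h1).elim

/-- Two words of the same length with the same irreversible window at the same position have the
same shape, provided that joint embedding holds for short words. -/
theorem sameShape_of_irreversible (hW : IsLocalClass b W) (hJ : JointUpTo W N)
    (hN : numShapes b * numShapes b * 8 + b ≤ N) (he : ¬ Reach b W e 1 e 0) :
    ∀ n f g p, W f 0 n → W g 0 n → p + (b + 1) ≤ n → SameShape f p e 0 (b + 1) →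
      SameShape g p e 0 (b + 1) → SameShape f 0 g 0 n := by
  intro n
  induction n using Nat.strong_induction_on with
  | _ n ih =>
  intro f g p hf hg hp hfe hge
  by_cases hn : n ≤ N
  -- In a common extension the two copies of `e` must coincide, so both words occupy the same
  -- window.
  · obtain ⟨h, l, s, t, a1, a2, a3, a4, a5⟩ := hJ f 0 n g 0 n hn hn hf hg
    have := hW.occurrence_unique he a1 (s := s + p) (t := t + p) (by omega) (by omega)
      ((a4.sub' p hp (by simp) rfl).symm.trans hfe) ((a5.sub' p hp (by simp) rfl).symm.trans hge)
    obtain rfl : s = t := by omega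
    exact a4.trans a5.symm
  by_contra hne
  -- a closest pair of points on which `f` and `g` differ
  have hex : ∃ d i, i + d < n ∧ ¬ (f i = f (i + d) ↔ g i = g (i + d)) := by
    simp only [SameShape, Nat.zero_add] at hne
    push Not at hne
    obtain ⟨i, hi, j, hj, hij⟩ := hne
    rcases le_total i j with hle | hle
    · refine ⟨j - i, i, by omega, ?_⟩
      rw [show i + (j - i) = j by omega]
      tauto
    · refine ⟨i - j, j, by omega, ?_⟩
      rw [show j + (i - j) = i by omega, eq_comm, @eq_comm _ (g j)]
      tauto
  classical
  obtain ⟨i, hid, hdiff⟩ := Nat.find_spec hex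
  have hmin := fun d (hd : d < Nat.find hex) => Nat.find_min hex hd
  generalize Nat.find hex = d at hid hdiff hmin
  have hd0 : d ≠ 0 := by
    rintro rfl
    simp at hdiff
  obtain ⟨j, hj⟩ : ∃ j, j = i + d := ⟨_, rfl⟩
  rw [← hj] at hid hdiff
  have hbetween : ∀ k, i < k → k < j → (f i = f k ↔ g i = g k) ∧ (f k = f j ↔ g k = g j) := by
    intro k hik hkj
    have h1 := hmin (k - i) (by omega)
    have h2 := hmin (j - k) (by omega)
    push Not at h1 h2
    have h1 := h1 i (by omega)
    have h2 := h2 k (by omega)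
    rw [show i + (k - i) = k by omega] at h1
    rw [show k + (j - k) = j by omega] at h2
    tauto
  -- A point strictly between, related to `i` or to `j`, would transfer the disagreement to a closer
  -- pair by transitivity.
  have hfi : ∀ k, i < k → k < j → f i ≠ f k := by
    intro k hik hkj e1
    obtain ⟨h1, h2⟩ := hbetween k hik hkj
    have e2 := h1.1 e1
    exact hdiff (by rw [e1, e2]; exact h2)
  have hfj : ∀ k, i < k → k < j → f j ≠ f k := by
    intro k hik hkj e1
    obtain ⟨h1, h2⟩ := hbetween k hik hkj
    have e2 := h2.1 e1.symm
    exact hdiff (by rw [e1, ← e2]; exact h1)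
  -- two starting points with equal windows, between which none of the marked positions lies
  obtain ⟨s, t, hst, htn, hc⟩ := exists_lt_map_eq (m := n - b + 1)
    (fun s => (((shapeAt b f s, shapeAt b g s) : _ × _),
      ((decide (p < s), decide (i < s), decide (j < s + b)) : Bool × Bool × Bool))) (by
      -- Two window shapes and three Boolean marks give the constant `numShapes b * numShapes b * 8`
      -- of `hN`.
      rw [Fintype.card_prod, Fintype.card_prod, card_shapes]
      simp only [Fintype.card_prod, Fintype.card_bool]
      omega)
  simp only [Prod.mk.injEq, decide_eq_decide] at hc
  obtain ⟨⟨hcf, hcg⟩, hcp, hci, hcj⟩ := hc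
  replace hcf := sameShape_of_shapeAt_eq hcf
  replace hcg := sameShape_of_shapeAt_eq hcg
  have occurs : ∀ F H, SameShape F p e 0 (b + 1) → SameShape H 0 F 0 (s + b) →
      SameShape H s F t (n - t) →
      SameShape H (if p < s then p else p - (t - s)) e 0 (b + 1) := by
    intro F H hF h1 h2
    split_ifs with hps
    · exact (h1.sub' p (by omega) (by simp) (by simp)).trans hF
    · exact (h2.sub' (p - t) (by omega) (by omega) (by omega)).trans hF
  have agree : ∀ F G H K, SameShape F p e 0 (b + 1) → SameShape G p e 0 (b + 1) →
      SameShape H 0 F 0 (s + b) → SameShape H s F t (n - t) → W H 0 (n - (t - s)) →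
      SameShape K 0 G 0 (s + b) → SameShape K s G t (n - t) → W K 0 (n - (t - s)) →
      SameShape H 0 K 0 (n - (t - s)) := by
    intro F G H K hF hG h1 h2 h3 k1 k2 k3
    refine ih (n - (t - s)) (by omega) H K _ h3 k3 ?_ (occurs F H hF h1 h2) (occurs G K hG k1 k2)
    split_ifs <;> omega
  -- If the overlap lies strictly between `i` and `j`, neither is related to it, so cutting `f`
  -- leaves free whether they are related. Both choices give shorter members containing `e` at the
  -- same position, against the induction hypothesis.
  by_cases hfar : i < s ∧ t + b ≤ j
  · obtain ⟨his, hjt⟩ := hfar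
    have hglue : ∀ c : Bool, ∃ H, SameShape H 0 f 0 (s + b) ∧ SameShape H s f t (n - t) ∧
        W H 0 (n - (t - s)) ∧ (H i = H (s + (j - t)) ↔ c = true) := by
      intro c
      obtain ⟨H, h1, h2, h3⟩ := exists_glue_choice f (fun x => f (t + x)) s b (n - t - b)
        (hcf.trans (SameShape.shift f t b).symm) i (j - t) c
        (fun _ k hk => hfi _ (by omega) (by omega))
      have h3 := h3 (by omega) (by omega) (fun k hk => by
        rw [show t + (j - t) = j by omega]
        exact hfj _ (by omega) (by omega))
      have h2 := h2.trans (SameShape.shift f t _)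
      have h4 := hW.of_glue (hW.mono hf le_rfl (by omega)) (hW.mono hf (by omega) (by omega)) h1 h2
      rw [show s + b + (n - t - b) = n - (t - s) by omega] at h4
      rw [show b + (n - t - b) = n - t by omega] at h2
      exact ⟨H, h1, h2, h4, h3⟩
    obtain ⟨H, h1, h2, h3, h4⟩ := hglue true
    obtain ⟨K, k1, k2, k3, k4⟩ := hglue false
    have := agree f f H K hfe hfe h1 h2 h3 k1 k2 k3 i (by omega) (s + (j - t)) (by omega)
    simp only [Nat.zero_add] at this
    rw [h4, k4] at this
    simp at this
  -- Otherwise the marks put `i` and `j` both in the retained prefix or both in the retained suffix,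
  -- so the disagreement survives cutting `f` and `g`.
  · obtain ⟨H, h1, h2, h3⟩ := hW.cut hf hst (by omega) hcf
    obtain ⟨K, k1, k2, k3⟩ := hW.cut hg hst (by omega) hcg
    have hHK := agree f g H K hfe hge h1 h2 h3 k1 k2 k3
    by_cases his : i < s
    · have := (h1.symm.trans (hHK.take (by omega))).trans k1
      exact hdiff (by simpa using this i (by omega) j (by omega))
    · have := (h2.symm.trans (hHK.sub' s (m := n - t) (by omega) (by simp) (by simp))).trans k2
      have := this (i - t) (by omega) (j - t) (by omega)
      rw [show t + (i - t) = i by omega, show t + (j - t) = j by omega] at this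
      exact hdiff this

/-! ### From joint embedding of short words to all words -/

theorem compat_of_reach (hW : IsLocalClass b W) (hf : W f 0 (n + b)) (hg : W g 0 (b + m))
    (H : Reach b W f n g 0) : Compat W f 0 (n + b) g 0 (b + m) := by
  obtain ⟨h, k, a1, a2, a3⟩ := H
  obtain ⟨u, b1, b2, b3⟩ := hW.glue a1 hg (by simpa using a3)
  rw [show k + b + m = b + (k + m) by omega] at b3
  obtain ⟨v, c1, c2, c3⟩ := hW.glue hf b3
    (by rw [Nat.zero_add]; exact (a2.symm.trans (b1.take (by omega)).symm))
  refine ⟨v, _, 0, n + k, c3, by omega, by omega, c1.symm, ?_⟩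
  exact (b2.symm.trans (c2.sub' k (by omega) rfl (by simp)).symm)

theorem reach_total (hW : IsLocalClass b W) (hJ : JointUpTo W N) (hN : b ≤ N) (hf : W f p b)
    (hg : W g q b) : Reach b W f p g q ∨ Reach b W g q f p := by
  obtain ⟨h, l, s, t, a1, a2, a3, a4, a5⟩ := hJ f p b g q b hN hN hf hg
  rcases le_total s t with hst | hst
  · exact Or.inl (hW.reach_of_le a1 (Nat.zero_le _) hst (by omega) a4.symm a5.symm)
  · exact Or.inr (hW.reach_of_le a1 (Nat.zero_le _) hst (by omega) a5.symm a4.symm)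

/-- Each window lies before or after a given window of length `b + 1`. -/
theorem reach_or_reach (hW : IsLocalClass b W) (hJ : JointUpTo W N) (hN : b < N)
    (he : W e 0 (b + 1)) (hg : W g q b) : Reach b W g q e 0 ∨ Reach b W e 1 g q := by
  obtain ⟨h, l, s, t, a1, a2, a3, a4, a5⟩ := hJ e 0 (b + 1) g q b hN hN.le he hg
  rcases le_or_gt t s with hst | hst
  · exact Or.inl (hW.reach_of_le a1 (Nat.zero_le _) hst (by omega) a5.symm
      (a4.take (by omega)).symm)
  · exact Or.inr (hW.reach_of_le a1 (Nat.zero_le _) (Nat.succ_le_of_lt hst) (by omega)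
      (a4.sub' 1 (by omega) rfl rfl).symm a5.symm)

/-- If `e` can be attached at neither end of `g`, the windows of `g` change somewhere from reaching
`e` to not reaching it; that edge of `g` is `e` itself. -/
theorem compat_irreversible (hW : IsLocalClass b W) (hJ : JointUpTo W N) (hN : b < N)
    (he : W e 0 (b + 1)) (hirr : ¬ Reach b W e 1 e 0) (hg : W g 0 (b + m)) :
    Compat W g 0 (b + m) e 0 (b + 1) := by
  by_cases h1 : Reach b W g m e 0
  · rw [Nat.add_comm b m] at hg ⊢
    exact hW.compat_of_reach hg he h1
  by_cases h2 : Reach b W e 1 g 0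
  · refine Compat.symm ?_
    rw [Nat.add_comm] at he
    rw [Nat.add_comm b 1]
    exact hW.compat_of_reach he hg h2
  have hor : ∀ k ≤ m, Reach b W g k e 0 ∨ Reach b W e 1 g k := fun k hk =>
    hW.reach_or_reach hJ hN he (hW.mono hg (Nat.zero_le _) (by omega))
  obtain ⟨k, hkm, hk, hk'⟩ : ∃ k < m, Reach b W g k e 0 ∧ ¬ Reach b W g (k + 1) e 0 := by
    by_contra hcon
    push Not at hcon
    have : ∀ k ≤ m, Reach b W g k e 0 := by
      intro k
      induction k with
      | zero => exact fun hk => (hor 0 hk).resolve_right h2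
      | succ k ih => exact fun hk => hcon k hk (ih (by omega))
    exact h1 (this m le_rfl)
  have hk1 := (hor (k + 1) hkm).resolve_left hk'
  have hgk : W g k (b + 1) := hW.mono hg (Nat.zero_le _) (by omega)
  -- In a common extension, `e` before the edge at `k` would make `e` reversible, and `e` after it
  -- would let window `k + 1` reach `e`; so they coincide.
  obtain ⟨h, l, s, t, a1, a2, a3, a4, a5⟩ := hJ e 0 (b + 1) g k (b + 1) hN hN he hgk
  rcases lt_trichotomy s t with hst | hst | hst
  · refine (hirr (hW.reach_trans ?_ hk)).elim
    exact hW.reach_of_le a1 (Nat.zero_le _) (Nat.succ_le_of_lt hst) (by omega)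
      (a4.sub' 1 (by omega) rfl rfl).symm (a5.take (by omega)).symm
  · subst hst
    exact ⟨g, _, 0, k, hg, by omega, by omega, SameShape.refl _ _ _, a4.trans a5.symm⟩
  · refine (hk' ?_).elim
    exact hW.reach_of_le a1 (Nat.zero_le _) (Nat.succ_le_of_lt hst) (by omega)
      (a5.sub' 1 (by omega) rfl rfl).symm (a4.take (by omega)).symm

/-- Two words that contain a common irreversible window occur together. -/
theorem compat_of_common_irreversible (hW : IsLocalClass b W) (hJ : JointUpTo W N)
    (hN : numShapes b * numShapes b * 8 + b ≤ N) (hirr : ¬ Reach b W e 1 e 0)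
    (hf : W f 0 n) (hg : W g 0 m) (hs : s + (b + 1) ≤ n) (ht : t + (b + 1) ≤ m)
    (hfe : SameShape f s e 0 (b + 1)) (hge : SameShape g t e 0 (b + 1)) :
    Compat W f 0 n g 0 m := by
  -- By rigidity, a word containing `e` is a window of any member with enough room on both sides of
  -- its `e`.
  have embed : ∀ {F k r Z l z}, W F 0 k → r + (b + 1) ≤ k → SameShape F r e 0 (b + 1) →
      W Z 0 l → SameShape Z z e 0 (b + 1) → r ≤ z → z + k ≤ l + r →
      SameShape F 0 Z (z - r) k := by
    intro F k r Z l z hF hr hFe hZ hZe hrz hzl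
    have hsh := SameShape.shift Z (z - r) k
    refine SameShape.trans ?_ hsh
    refine hW.sameShape_of_irreversible hJ hN hirr k F _ r hF
      (hW.congr hsh.symm (hW.mono hZ (Nat.zero_le _) (by omega))) hr hFe ?_
    exact (hsh.sub' r hr (by simp) (by omega)).trans hZe
  have merge : ∀ {F k r G l u}, W F 0 k → r + (b + 1) ≤ k → SameShape F r e 0 (b + 1) →
      W G 0 l → u + (b + 1) ≤ l → SameShape G u e 0 (b + 1) →
      ∃ Z, W Z 0 (r + (l - u)) ∧ SameShape Z r e 0 (b + 1) := by
    intro F k r G l u hF hr hFe hG hu hGe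
    obtain ⟨Z, h1, h2, h3⟩ := hW.glue (f := F) (g := G) (p := 0) (q := u) (n := r)
      (m := l - u - b) (hW.mono hF le_rfl (by omega)) (hW.mono hG (Nat.zero_le _) (by omega))
      (by rw [Nat.zero_add]; exact (hFe.take (by omega)).trans (hGe.take (by omega)).symm)
    rw [show r + b + (l - u - b) = r + (l - u) by omega] at h3
    exact ⟨Z, h3, (h2.take (by omega)).trans hGe⟩
  -- `Z` combines the longer part to the left of `e` with the longer part to its right.
  obtain ⟨Z, z, l, hZ, hZe, hsz, htz, hn, hm⟩ : ∃ Z z l, W Z 0 l ∧ SameShape Z z e 0 (b + 1) ∧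
      s ≤ z ∧ t ≤ z ∧ z + n ≤ l + s ∧ z + m ≤ l + t := by
    rcases le_total s t with hst | hst <;> rcases le_total (n - s) (m - t) with hr | hr
    · exact ⟨g, t, m, hg, hge, hst, le_rfl, by omega, by omega⟩
    · obtain ⟨Z, h1, h2⟩ := merge hg ht hge hf hs hfe
      exact ⟨Z, t, _, h1, h2, hst, le_rfl, by omega, by omega⟩
    · obtain ⟨Z, h1, h2⟩ := merge hf hs hfe hg ht hge
      exact ⟨Z, s, _, h1, h2, le_rfl, hst, by omega, by omega⟩
    · exact ⟨f, s, n, hf, hfe, le_rfl, hst, by omega, by omega⟩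
  exact ⟨Z, l, z - s, z - t, hZ, by omega, by omega, embed hf hs hfe hZ hZe hsz hn,
    embed hg ht hge hZ hZe htz hm⟩

/-- A member containing `g` and the irreversible edge of `f` is superimposed on `f` along that edge.
-/
theorem compat_of_irreversible (hW : IsLocalClass b W) (hJ : JointUpTo W N)
    (hN : numShapes b * numShapes b * 8 + b ≤ N) (hf : W f 0 (b + n)) (hg : W g 0 (b + m))
    (hs : s < n) (hirr : ¬ Reach b W f (s + 1) f s) : Compat W f 0 (b + n) g 0 (b + m) := by
  have hbN : b < N := by
    have : 0 < numShapes b * numShapes b := by simp [numShapes]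
    omega
  have hsh := SameShape.shift f s (b + 1)
  have hirr' : ¬ Reach b W (fun i => f (s + i)) 1 (fun i => f (s + i)) 0 := by
    rintro ⟨h, k, h1, h2, h3⟩
    exact hirr ⟨h, k, h1, h2.trans (hsh.sub' 1 (by omega) rfl rfl),
      h3.trans (hsh.take (by omega))⟩
  have he := hW.congr hsh.symm (hW.mono hf (Nat.zero_le s) (by omega))
  obtain ⟨h, l, u, t, a1, a2, a3, a4, a5⟩ := hW.compat_irreversible hJ hbN he hirr' hg
  obtain ⟨k, L, x, y, c1, c2, c3, c4, c5⟩ := hW.compat_of_common_irreversible hJ hN hirr' hf a1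
    (by omega) a3 hsh.symm a5.symm
  refine ⟨k, L, x, y + u, c1, c2, by omega, c4, a4.trans ?_⟩
  exact c5.sub' u a2 (Nat.zero_add u).symm rfl

theorem compat_of_long (hW : IsLocalClass b W) (hJ : JointUpTo W N)
    (hN : numShapes b * numShapes b * 8 + b ≤ N) (hf : W f 0 (b + n)) (hg : W g 0 (b + m)) :
    Compat W f 0 (b + n) g 0 (b + m) := by
  by_cases h1 : ∃ s < n, ¬ Reach b W f (s + 1) f s
  · obtain ⟨s, hs, h⟩ := h1
    exact hW.compat_of_irreversible hJ hN hf hg hs h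
  by_cases h2 : ∃ s < m, ¬ Reach b W g (s + 1) g s
  · obtain ⟨s, hs, h⟩ := h2
    exact (hW.compat_of_irreversible hJ hN hg hf hs h).symm
  push Not at h1 h2
  -- When every step is reversible, the word can be traversed backwards to its first window.
  have back : ∀ {F k}, W F 0 (b + k) → (∀ s < k, Reach b W F (s + 1) F s) →
      ∀ s ≤ k, Reach b W F s F 0 := by
    intro F k hF hb s
    induction s with
    | zero =>
      intro _
      exact hW.reach_of_le hF le_rfl le_rfl (by omega) (SameShape.refl _ _ _)
        (SameShape.refl _ _ _)
    | succ s ih => exact fun hs => hW.reach_trans (hb s hs) (ih (by omega))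
  have forth : Reach b W g 0 g m := hW.reach_of_le hg le_rfl (Nat.zero_le _) (by omega)
    (SameShape.refl _ _ _) (SameShape.refl _ _ _)
  rcases hW.reach_total hJ (by omega) (hW.mono hf (Nat.zero_le n) (by omega))
    (hW.mono hg (Nat.zero_le m) (by omega)) with h | h
  · rw [Nat.add_comm b n] at hf ⊢
    exact hW.compat_of_reach hf hg (hW.reach_trans h (back hg h2 m le_rfl))
  · refine Compat.symm ?_
    rw [Nat.add_comm b m] at hg ⊢
    exact hW.compat_of_reach hg hf (hW.reach_trans h (back hf h1 n le_rfl))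

/-- Joint embedding for short words implies joint embedding. -/
theorem compat_of_jointUpTo (hW : IsLocalClass b W) (hJ : JointUpTo W N)
    (hN : numShapes b * numShapes b * 8 + b ≤ N) (hf : W f p n) (hg : W g q m) :
    Compat W f p n g q m := by
  by_cases hlong : ∃ k r, W k r b
  -- Words shorter than `b` are first extended, by joint embedding with a member of length `b`; if
  -- there is none, all members are short enough for `hJ`.
  · obtain ⟨k, r, hk⟩ := hlong
    have extend : ∀ {F x y}, W F x y → ∃ G z u, W G 0 (b + z) ∧ u + y ≤ b + z ∧
        SameShape F x G u y := by
      intro F x y hF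
      rcases le_total b y with hy | hy
      · refine ⟨fun i => F (x + i), y - b, 0, ?_, by omega, (SameShape.shift F x y).symm⟩
        rw [show b + (y - b) = y by omega]
        exact hW.congr (SameShape.shift F x y).symm hF
      · obtain ⟨h, l, s, t, a1, a2, a3, a4, a5⟩ := hJ F x y k r b (by omega) (by omega) hF hk
        refine ⟨h, l - b, s, ?_, by omega, a4⟩
        rwa [show b + (l - b) = l by omega]
    obtain ⟨F, n', u, hF, hu, hfF⟩ := extend hf
    obtain ⟨G, m', v, hG, hv, hgG⟩ := extend hg
    obtain ⟨h, l, s, t, a1, a2, a3, a4, a5⟩ := hW.compat_of_long hJ hN hF hG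
    exact ⟨h, l, s + u, t + v, a1, by omega, by omega,
      hfF.trans (a4.sub' u hu (Nat.zero_add u).symm rfl),
      hgG.trans (a5.sub' v hv (Nat.zero_add v).symm rfl)⟩
  · have short : ∀ {F x y}, W F x y → y < b := by
      intro F x y hF
      by_contra hy
      exact hlong ⟨F, x, hW.mono hF le_rfl (by omega)⟩
    exact hJ f p n g q m (by have := short hf; omega) (by have := short hg; omega) hf hg

/-! ### Bounding common extensions -/

/-- Words of length at most `N` that occur together do so in a word of bounded length. -/
theorem exists_short_of_compat (hW : IsLocalClass b W) (hn : n ≤ N) (hm : m ≤ N)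
    (H : Compat W f p n g q m) :
    ∃ h l s t, l ≤ numShapes b * ((N + 2) * (N + 2)) + b ∧ W h 0 l ∧ s + n ≤ l ∧ t + m ≤ l ∧
      SameShape f p h s n ∧ SameShape g q h t m := by
  obtain ⟨h, l, s, t, a1, a2, a3, a4, a5⟩ := H
  induction l using Nat.strong_induction_on generalizing h s t with
  | _ l ih =>
  by_cases hl : l ≤ numShapes b * ((N + 2) * (N + 2)) + b
  · exact ⟨h, l, s, t, hl, a1, a2, a3, a4, a5⟩
  obtain ⟨x, y, hxy, hyl, hc⟩ := exists_lt_map_eq (m := l - b + 1)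
    -- The truncated offset is `0` at or before the start of an occurrence and `N + 1` only past its
    -- end. Equal offsets at `x < y` thus keep each occurrence intact, in the prefix or the suffix
    -- of the cut.
    (fun x => (shapeAt b h x, ((⟨min (x - s) (N + 1), by omega⟩,
      ⟨min (x - t) (N + 1), by omega⟩) : Fin (N + 2) × Fin (N + 2)))) (by
      rw [Fintype.card_prod, card_shapes]
      simp only [Fintype.card_prod, Fintype.card_fin]
      omega)
  simp only [Prod.mk.injEq, Fin.mk.injEq] at hc
  obtain ⟨hch, hcs, hct⟩ := hc
  obtain ⟨k, c1, c2, c3⟩ := hW.cut a1 hxy (by omega) (sameShape_of_shapeAt_eq hch)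
  have move : ∀ {F r i u}, min (x - u) (N + 1) = min (y - u) (N + 1) → i ≤ N → u + i ≤ l →
      SameShape F r h u i → ∃ u', u' + i ≤ l - (y - x) ∧ SameShape F r k u' i := by
    intro F r i u hmin hi hu hF
    by_cases hyu : y ≤ u
    · exact ⟨u - (y - x), by omega,
        hF.trans (c2.sub' (u - y) (by omega) (by omega) (by omega)).symm⟩
    · exact ⟨u, by omega, hF.trans (c1.sub' u (by omega) (by simp) (by simp)).symm⟩
  obtain ⟨s', hs', hs⟩ := move hcs hn a2 a4
  obtain ⟨t', ht', ht⟩ := move hct hm a3 a5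
  exact ih (l - (y - x)) (by omega) k s' t' c3 hs' ht' hs ht

end IsLocalClass

/-! ### Avoidance sets as local classes of label lists -/

/-- The label function of a list of labels. -/
def lab (w : List ℕ) (i : ℕ) : ℕ := w.getD i 0

/-- Consecutive embedding of label lists. -/
def WordEmbeds (w v : List ℕ) : Prop :=
  ∃ k, k + w.length ≤ v.length ∧ SameShape (lab w) 0 (lab v) k w.length

theorem ofLabels_le_iff {w v : List ℕ} : ofLabels w ≤ ofLabels v ↔ WordEmbeds w v := by
  have hget : ∀ (u : List ℕ) (i : ℕ) (h : i < u.length), u.get ⟨i, h⟩ = lab u i := by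
    intro u i h
    simp [lab, h]
  constructor
  · rintro ⟨k, h, H⟩
    refine ⟨k, h, fun i hi j hj => ?_⟩
    have hk : k + w.length ≤ v.length := h
    rw [Nat.zero_add, Nat.zero_add, ← hget w i hi, ← hget w j hj,
      ← hget v (k + i) (by omega), ← hget v (k + j) (by omega)]
    exact H ⟨i, hi⟩ ⟨j, hj⟩
  · rintro ⟨k, h, H⟩
    refine ⟨k, h, fun i j => ?_⟩
    obtain ⟨i, hi⟩ := i
    obtain ⟨j, hj⟩ := j
    change i < w.length at hi
    change j < w.length at hj
    have := H i hi j hj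
    rw [Nat.zero_add, Nat.zero_add, ← hget w i hi, ← hget w j hj,
      ← hget v (k + i) (by omega), ← hget v (k + j) (by omega)] at this
    exact this

/-- No member of `L` embeds in the window of length `n` of `f` at `p`. -/
def Avoids (L : List (List ℕ)) (f : ℕ → ℕ) (p n : ℕ) : Prop :=
  ∀ w ∈ L, ∀ k, k + w.length ≤ n → ¬ SameShape (lab w) 0 f (p + k) w.length

/-- A bound for the lengths of the members of `L`. -/
def width (L : List (List ℕ)) : ℕ := L.flatten.length

theorem length_le_width {L : List (List ℕ)} {w : List ℕ} (hw : w ∈ L) : w.length ≤ width L :=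
  (List.sublist_flatten_of_mem hw).length_le

/-- A forbidden word has length at most `width L`, so an occurrence in the appended window lies
entirely in one of the two overlapping pieces. -/
theorem isLocalClass_avoids (L : List (List ℕ)) : IsLocalClass (width L) (Avoids L) where
  mono := by
    intro f p n q m H hpq hqm w hw k hk hs
    exact H w hw (q - p + k) (by omega) (by rwa [show p + (q - p + k) = q + k by omega])
  congr := by
    intro f p g q n hs H w hw k hk hs'
    exact H w hw k hk (hs'.trans (hs.sub k hk).symm)
  append := by
    intro f p n m H1 H2 w hw k hk hs
    have hlen := length_le_width hw
    rcases le_total k n with h | h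
    · exact H1 w hw k (by omega) hs
    · exact H2 w hw (k - n) (by omega) (by rwa [show p + n + (k - n) = p + k by omega])

theorem avoids_iff {L : List (List ℕ)} {v : List ℕ} :
    Avoids L (lab v) 0 v.length ↔ ∀ w ∈ L, ¬ WordEmbeds w v := by
  simp only [Avoids, WordEmbeds, not_exists, not_and, Nat.zero_add]

theorem ofLabels_mem_av {L : List (List ℕ)} {v : List ℕ} :
    ofLabels v ∈ Av (presented L) ↔ Avoids L (lab v) 0 v.length := by
  rw [avoids_iff]
  constructor
  · intro h w hw hwv
    exact h _ ⟨w, hw, rfl⟩ (ofLabels_le_iff.2 hwv)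
  · rintro h _ ⟨w, hw, rfl⟩ hle
    exact h w hw (ofLabels_le_iff.1 hle)

/-- An avoidance set is atomic if and only if it has the joint embedding property. -/
theorem atomic_av_iff {X : Type*} [PartialOrder X] (B : Set X) :
    Atomic (Av B) ↔ ∀ x ∈ Av B, ∀ y ∈ Av B, ∃ z ∈ Av B, x ≤ z ∧ y ≤ z := by
  have hlow : IsLowerSet (Av B) := fun x y hyx hx w hw hwy => hx w hw (hwy.trans hyx)
  constructor
  · rintro ⟨-, h⟩ x hx y hy
    by_contra hcon
    push Not at hcon
    -- Without a common upper bound, every member avoids `x` or avoids `y`.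
    refine h ⟨{z ∈ Av B | ¬ x ≤ z}, {z ∈ Av B | ¬ y ≤ z}, ?_, ?_, ?_, ?_, ?_⟩
    · exact fun a b hba ha => ⟨hlow hba ha.1, fun hxb => ha.2 (hxb.trans hba)⟩
    · exact fun a b hba ha => ⟨hlow hba ha.1, fun hxb => ha.2 (hxb.trans hba)⟩
    · exact ⟨fun z hz => hz.1, fun hs => (hs hx).2 le_rfl⟩
    · exact ⟨fun z hz => hz.1, fun hs => (hs hy).2 le_rfl⟩
    · ext z
      constructor
      · intro hz
        by_cases hxz : x ≤ z
        · exact Or.inr ⟨hz, hcon z hz hxz⟩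
        · exact Or.inl ⟨hz, hxz⟩
      · rintro (hz | hz) <;> exact hz.1
  · intro h
    refine ⟨hlow, ?_⟩
    rintro ⟨D, E, hD, hE, hDC, hEC, hDE⟩
    obtain ⟨x, hx, hxD⟩ := Set.exists_of_ssubset hDC
    obtain ⟨y, hy, hyE⟩ := Set.exists_of_ssubset hEC
    obtain ⟨z, hz, hxz, hyz⟩ := h x hx y hy
    rw [hDE] at hz
    rcases hz with hz | hz
    · exact hxD (hD hxz hz)
    · exact hyE (hE hyz hz)

/-! ### Reduction to a bounded search -/

/-- The words of length at most `n` with labels less than `k`. -/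
def wordsBelow (k : ℕ) : ℕ → List (List ℕ)
  | 0 => [[]]
  | n + 1 => [] :: (wordsBelow k n).flatMap fun w => (List.range k).map fun a => a :: w

theorem mem_wordsBelow {k n : ℕ} {w : List ℕ} :
    w ∈ wordsBelow k n ↔ w.length ≤ n ∧ ∀ a ∈ w, a < k := by
  induction n generalizing w with
  | zero => cases w <;> simp [wordsBelow]
  | succ n ih => cases w <;> simp [wordsBelow, ih, and_assoc, and_left_comm]

/-- Every shape occurs among the words with labels less than the length. -/
theorem exists_word (f : ℕ → ℕ) (p n N : ℕ) (hn : n ≤ N) :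
    ∃ w ∈ wordsBelow N N, w.length = n ∧ SameShape (lab w) 0 f p n := by
  have hex : ∀ i, ∃ j, f (p + j) = f (p + i) := fun i => ⟨i, rfl⟩
  -- Each point is relabelled by the first position in the window carrying its label.
  refine ⟨(List.range n).map fun i => Nat.find (hex i), mem_wordsBelow.2 ⟨by simpa, ?_⟩,
    by simp, ?_⟩
  · intro a ha
    obtain ⟨i, hi, rfl⟩ := List.mem_map.1 ha
    have h1 : Nat.find (hex i) ≤ i := Nat.find_min' (hex i) rfl
    have h2 := List.mem_range.1 hi
    omega
  · intro i hi j hj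
    simp only [lab, List.getD_eq_getElem?_getD, List.getElem?_map, Nat.zero_add,
      List.getElem?_range hi, List.getElem?_range hj, Option.map_some, Option.getD_some]
    constructor
    · intro h
      rw [← Nat.find_spec (hex i), ← Nat.find_spec (hex j), h]
    · intro h
      simp only [h]

/-- The length up to which joint embedding has to be checked for windows of length `b`. -/
def testLength (b : ℕ) : ℕ := numShapes b * numShapes b * 8 + b

/-- The length up to which common extensions have to be searched. -/
def searchLength (b : ℕ) : ℕ :=
  numShapes b * ((testLength b + 2) * (testLength b + 2)) + b

/-- The list of words with length and labels bounded by `N`. -/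
def wordsUpTo (N : ℕ) : List (List ℕ) := wordsBelow N N

/-- The bounded form of the joint embedding property of an avoidance set. -/
def BoundedJoint (L : List (List ℕ)) : Prop :=
  ∀ w ∈ wordsUpTo (testLength (width L)), ∀ v ∈ wordsUpTo (testLength (width L)),
    (∃ u ∈ L, WordEmbeds u w) ∨ (∃ u ∈ L, WordEmbeds u v) ∨
      ∃ z ∈ wordsUpTo (searchLength (width L)),
        (¬ ∃ u ∈ L, WordEmbeds u z) ∧ WordEmbeds w z ∧ WordEmbeds v z

/-- Forwards, `exists_short_of_compat` shortens the common extension; backwards, the bounded test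
yields `JointUpTo`, and `compat_of_jointUpTo` does the rest. -/
theorem atomic_iff_boundedJoint (L : List (List ℕ)) :
    Atomic (Av (presented L)) ↔ BoundedJoint L := by
  rw [atomic_av_iff]
  have hW := isLocalClass_avoids L
  have hav : ∀ w, (¬ ∃ u ∈ L, WordEmbeds u w) ↔ Avoids L (lab w) 0 w.length := by
    intro w
    simp [avoids_iff]
  constructor
  · intro h w hw v hv
    by_cases hwL : ∃ u ∈ L, WordEmbeds u w
    · exact Or.inl hwL
    by_cases hvL : ∃ u ∈ L, WordEmbeds u v
    · exact Or.inr (Or.inl hvL)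
    rw [hav] at hwL hvL
    obtain ⟨ρ, hρ, h1, h2⟩ := h _ (ofLabels_mem_av.2 hwL) _ (ofLabels_mem_av.2 hvL)
    obtain ⟨r, rfl⟩ := ofLabels_surjective ρ
    obtain ⟨s, hs, hs'⟩ := ofLabels_le_iff.1 h1
    obtain ⟨t, ht, ht'⟩ := ofLabels_le_iff.1 h2
    obtain ⟨g, l, x, y, hl, a1, a2, a3, a4, a5⟩ := hW.exists_short_of_compat
      (mem_wordsBelow.1 hw).1 (mem_wordsBelow.1 hv).1
      ⟨lab r, r.length, s, t, ofLabels_mem_av.1 hρ, hs, ht, hs', ht'⟩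
    obtain ⟨z, hz, rfl, hzg⟩ := exists_word g 0 l (searchLength (width L)) hl
    refine Or.inr (Or.inr ⟨z, hz, (hav z).2 (hW.congr hzg.symm a1), ⟨x, a2, ?_⟩, ⟨y, a3, ?_⟩⟩)
    · exact a4.trans (hzg.sub' x a2 (by simp) (by simp)).symm
    · exact a5.trans (hzg.sub' y a3 (by simp) (by simp)).symm
  · intro h
    have hJ : JointUpTo (Avoids L) (testLength (width L)) := by
      intro f p n g q m hn hm hf hg
      obtain ⟨w, hw, rfl, hwf⟩ := exists_word f p n _ hn
      obtain ⟨v, hv, rfl, hvg⟩ := exists_word g q m _ hm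
      rcases h w hw v hv with hc | hc | ⟨z, -, hz, ⟨s, hs, hs'⟩, ⟨t, ht, ht'⟩⟩
      · exact absurd hc ((hav w).2 (hW.congr hwf.symm hf))
      · exact absurd hc ((hav v).2 (hW.congr hvg.symm hg))
      · exact ⟨lab z, z.length, s, t, (hav z).1 hz, hs, ht, hwf.symm.trans hs',
          hvg.symm.trans ht'⟩
    intro x hx y hy
    obtain ⟨w, rfl⟩ := ofLabels_surjective x
    obtain ⟨v, rfl⟩ := ofLabels_surjective y
    obtain ⟨g, l, s, t, a1, a2, a3, a4, a5⟩ := hW.compat_of_jointUpTo hJ le_rfl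
      (ofLabels_mem_av.1 hx) (ofLabels_mem_av.1 hy)
    obtain ⟨z, -, rfl, hzg⟩ := exists_word g 0 l l le_rfl
    refine ⟨ofLabels z, ofLabels_mem_av.2 (hW.congr hzg.symm a1), ofLabels_le_iff.2 ⟨s, a2, ?_⟩,
      ofLabels_le_iff.2 ⟨t, a3, ?_⟩⟩
    · exact a4.trans (hzg.sub' s a2 (by simp) (by simp)).symm
    · exact a5.trans (hzg.sub' t a3 (by simp) (by simp)).symm

/-! ### Primitive recursiveness of the search -/

section Computability

open Primrec

variable {α β : Type*} [Primcodable α] [Primcodable β]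

theorem primrecPred_exists_mem {l : α → List β} {R : α → β → Prop} (hl : Primrec l)
    (hR : PrimrecPred fun x : β × α => R x.2 x.1) : PrimrecPred fun a => ∃ b ∈ l a, R a b :=
  (PrimrecRel.exists_mem_list (R := fun b a => R a b) hR).comp hl Primrec.id

theorem primrecPred_forall_mem {l : α → List β} {R : α → β → Prop} (hl : Primrec l)
    (hR : PrimrecPred fun x : β × α => R x.2 x.1) : PrimrecPred fun a => ∀ b ∈ l a, R a b :=
  (PrimrecRel.forall_mem_list (R := fun b a => R a b) hR).comp hl Primrec.id

theorem primrecPred_iff {p q : α → Prop} (hp : PrimrecPred p) (hq : PrimrecPred q) :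
    PrimrecPred fun a => (p a ↔ q a) :=
  ((hp.and hq).or (hp.not.and hq.not)).of_eq fun a => by tauto

theorem primrec_lab : Primrec₂ lab := list_getD 0

theorem primrecRel_wordEmbeds : PrimrecRel WordEmbeds := by
  have hlab : ∀ {γ : Type} [Primcodable γ] {u : γ → List ℕ} {k : γ → ℕ}, Primrec u → Primrec k →
      Primrec fun x => lab (u x) (k x) := fun hu hk => primrec_lab.comp hu hk
  -- All quantifiers are bounded by list ranges; the `+ 1` admits the last possible offset,
  -- including that of an empty word.
  have H : PrimrecPred fun x : List ℕ × List ℕ => ∃ k ∈ List.range (x.2.length + 1),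
      k + x.1.length ≤ x.2.length ∧ ∀ i ∈ List.range x.1.length, ∀ j ∈ List.range x.1.length,
        (lab x.1 i = lab x.1 j ↔ lab x.2 (k + i) = lab x.2 (k + j)) := by
    refine primrecPred_exists_mem (list_range.comp (succ.comp (list_length.comp snd))) ?_
    refine PrimrecPred.and (nat_le.comp (nat_add.comp fst (list_length.comp (fst.comp snd)))
      (list_length.comp (snd.comp snd))) ?_
    refine primrecPred_forall_mem (list_range.comp (list_length.comp (fst.comp snd))) ?_
    refine primrecPred_forall_mem (list_range.comp (list_length.comp
      (fst.comp (snd.comp snd)))) ?_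
    have w : Primrec fun x : ℕ × ℕ × ℕ × List ℕ × List ℕ => x.2.2.2.1 :=
      fst.comp (snd.comp (snd.comp snd))
    have v : Primrec fun x : ℕ × ℕ × ℕ × List ℕ × List ℕ => x.2.2.2.2 :=
      snd.comp (snd.comp (snd.comp snd))
    have k : Primrec fun x : ℕ × ℕ × ℕ × List ℕ × List ℕ => x.2.2.1 :=
      fst.comp (snd.comp snd)
    have i : Primrec fun x : ℕ × ℕ × ℕ × List ℕ × List ℕ => x.2.1 := fst.comp snd
    exact primrecPred_iff (Primrec.eq.comp (hlab w i) (hlab w fst))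
      (Primrec.eq.comp (hlab v (nat_add.comp k i)) (hlab v (nat_add.comp k fst)))
  refine PrimrecPred.of_eq H fun x => ?_
  simp only [WordEmbeds, SameShape, List.mem_range, Nat.zero_add]
  constructor
  · rintro ⟨k, -, hk⟩
    exact ⟨k, hk⟩
  · rintro ⟨k, hk⟩
    exact ⟨k, by omega, hk⟩

theorem primrec_numShapes : Primrec numShapes := by
  have : Primrec fun b : ℕ => (fun x => 2 * x)^[b * b] 1 :=
    nat_iterate (nat_mul.comp Primrec.id Primrec.id) (const 1)
      (nat_mul.comp (const 2) snd)
  refine this.of_eq fun b => ?_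
  simp [numShapes, mul_left_iterate]

theorem primrec_wordsUpTo : Primrec wordsUpTo := by
  -- The alphabet size `N` stays a fixed parameter while the recursion runs over the length, which
  -- is also bounded by `N`.
  have : Primrec fun N : ℕ => (Nat.rec [[]]
      (fun _ l => [] :: l.flatMap fun w => (List.range N).map fun a => a :: w) N :
        List (List ℕ)) := by
    refine nat_rec' (h := fun N (x : ℕ × List (List ℕ)) =>
      [] :: x.2.flatMap fun w => (List.range N).map fun a => a :: w)
      Primrec.id (const [[]]) ?_
    refine list_cons.comp (const []) (list_flatMap (snd.comp snd) ?_)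
    exact list_map (list_range.comp (fst.comp fst)) (list_cons.comp snd (snd.comp fst))
  refine this.of_eq fun N => ?_
  have key : ∀ n, (Nat.rec [[]]
      (fun _ l => [] :: l.flatMap fun w => (List.range N).map fun a => a :: w) n :
        List (List ℕ)) = wordsBelow N n := by
    intro n
    induction n with
    | zero => rfl
    | succ n ih => simp only [ih, wordsBelow]
  exact key N

theorem primrec_width : Primrec width := list_length.comp list_flatten

theorem primrec_testLength : Primrec testLength :=
  nat_add.comp (nat_mul.comp (nat_mul.comp primrec_numShapes primrec_numShapes) (const 8))
    Primrec.id

theorem primrec_searchLength : Primrec searchLength :=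
  have h : Primrec fun b => testLength b + 2 := nat_add.comp primrec_testLength (const 2)
  nat_add.comp (nat_mul.comp primrec_numShapes (nat_mul.comp h h)) Primrec.id

theorem primrecPred_boundedJoint : PrimrecPred BoundedJoint := by
  have test : Primrec fun L => wordsUpTo (testLength (width L)) :=
    primrec_wordsUpTo.comp (primrec_testLength.comp primrec_width)
  have search : Primrec fun L => wordsUpTo (searchLength (width L)) :=
    primrec_wordsUpTo.comp (primrec_searchLength.comp primrec_width)
  have contains : PrimrecPred fun x : List (List ℕ) × List ℕ => ∃ u ∈ x.1, WordEmbeds u x.2 :=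
    primrecPred_exists_mem fst (primrecRel_wordEmbeds.comp fst (snd.comp snd))
  refine primrecPred_forall_mem test (primrecPred_forall_mem (test.comp snd) ?_)
  refine (contains.comp ((snd.comp snd).pair (fst.comp snd))).or
    ((contains.comp ((snd.comp snd).pair fst)).or ?_)
  refine primrecPred_exists_mem (search.comp (snd.comp snd)) ?_
  refine (contains.comp ((snd.comp (snd.comp snd)).pair fst)).not.and ?_
  exact (primrecRel_wordEmbeds.comp (fst.comp (snd.comp snd)) fst).and
    (primrecRel_wordEmbeds.comp (fst.comp snd) fst)

end Computability

end ConsEq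

/-- The atomicity problem under the consecutive embedding order is decidable: one algorithm,
given any finite set `B` of finite equivalence relations (as a list of lists of class labels),
decides whether the avoidance set of `B` is atomic. -/
theorem theorem9p8 :
    ComputablePred (fun L : List (List ℕ) => ConsEq.Atomic (ConsEq.Av (ConsEq.presented L))) := by
  exact ConsEq.primrecPred_boundedJoint.computablePred.of_eq fun L =>
    (ConsEq.atomic_iff_boundedJoint L).symm
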